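/- A scheme $S$ is called a Poonen scheme if for every nonempty open $U\subseteq S$ and every dominant morphism of finite presentation $f:X\to U$ there is a point $x\in X$ such that the residue field extension $\kappa(f(x))\subseteq\kappa(x)$ is purely inseparable. A commutative ring $A$ is a Poonen ring if $\operatorname{Spec}(A)$ is a Poonen scheme. A ring $A$ satisfies (P2) if for every nonconstant polynomial $F\in A[Y]$ there exists $b\in A$ such that $F(b)\notin A^\times$. Let $A$ be an integral domain with fraction field $K$, and let $|\cdot|:K\to\bar\Gamma$ be either a real absolute value in the usual sense (with $\bar\Gamma=\mathbb{R}_{\ge 0}$), or a valuation written multiplicatively with values in $\bar\Gamma=\Gamma\cup\{0\}$, where $\Gamma$ is an arbitrary totally ordered abelian group and $0<\Gamma$. Assume that $|A|$ is not bounded above in $\bar\Gamma$ but $|A^\times|$ is bounded above in $\bar\Gamma$. Then $A$ satisfies (P2), and $A$ is a Poonen ring. In particular, $\mathbb{Z}$, and the polynomial ring $k[t]$ for every field $k$, satisfy (P2) and are Poonen rings. -/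

import Mathlib

universe u v w

open AlgebraicGeometry CategoryTheory Polynomial

namespace PoonenScheme

/-- The points `x` of `X` such that the residue field extension `κ(f(x)) ⊆ κ(x)` is purely
inseparable. -/
def qRelPoints {X S : Scheme.{u}} (f : X ⟶ S) : Set X :=
  {x | (f.residueFieldMap x).hom.IsPurelyInseparable}

/-- The points of the base that are images of points with purely inseparable residue field
extension. -/
def qRel {X S : Scheme.{u}} (f : X ⟶ S) : Set S :=
  (fun x : X => f x) '' qRelPoints f

/-- A scheme `S` is a Poonen scheme if for every nonempty open `U ⊆ S` and every dominant
`f : X ⟶ U` of finite presentation, there is a point of `X` whose residue field is purely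
inseparable over that of its image.  Finite presentation means locally of finite presentation,
quasi-compact and quasi-separated. -/
def IsPoonenScheme (S : Scheme.{u}) : Prop :=
  ∀ U : S.Opens, (U : Set S).Nonempty →
    ∀ (X : Scheme.{u}) (f : X ⟶ U.toScheme),
      LocallyOfFinitePresentation f → QuasiCompact f → QuasiSeparated f → IsDominant f →
        (qRel f).Nonempty

/-- A commutative ring is a Poonen ring if its spectrum is a Poonen scheme. -/
def IsPoonenRing (A : Type u) [CommRing A] : Prop :=
  IsPoonenScheme (Spec (CommRingCat.of A))

/-- Condition (P2): every nonconstant polynomial over `A` takes a non-unit value at some point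
of `A`. -/
def SatisfiesP2 (A : Type u) [CommRing A] : Prop :=
  ∀ F : A[X], 0 < F.natDegree → ∃ b : A, ¬ IsUnit (F.eval b)

end PoonenScheme

namespace PoonenScheme

/-! For nonconstant `F`, `|F(b)|` exceeds any bound once `|b|` is large, so some value outgrows all
units: this is (P2). To pass from (P2) to the Poonen property, take a closed point of the nonempty
generic fibre of an affine piece of `X`; its residue field `L` is finite over `K`. Write the
separable closure of `K` in `L` as `K(α)`; `L` is purely inseparable over it. By (P2), the minimal
polynomial of `α`, cleared of denominators, has a root `b` modulo some maximal ideal `p` avoiding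
those denominators (`SatisfiesP2.exists_isMaximal`). Specializing `α` to `b` and lying over give a
prime modulo which suitable powers of the generators become fractions over `A`
(`SatisfiesP2.exists_prime_of_finite`). Its contraction to the coordinate ring is the required
point. -/

/-! ### Growth of polynomials and (P2) -/

/-- A domain with an absolute value that is unbounded but bounded on units satisfies (P2). -/
lemma SatisfiesP2.of_abv {A : Type*} [CommRing A] [IsDomain A] {K : Type*} [Field K]
    [Algebra A K] [IsFractionRing A K] (abv : AbsoluteValue K ℝ)
    (hA : ¬ BddAbove (Set.range fun a : A => abv (algebraMap A K a)))
    (hu : BddAbove (Set.range fun a : Aˣ => abv (algebraMap A K (a : A)))) :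
    SatisfiesP2 A := by
  intro F hF
  by_contra! h
  obtain ⟨M, hM⟩ := hu
  have hz : ∀ n : ℕ, ∃ a : A, (n : ℝ) < abv (algebraMap A K a) := by
    intro n
    obtain ⟨_, ⟨a, rfl⟩, ha⟩ := not_bddAbove_iff.mp hA n
    exact ⟨a, ha⟩
  choose z hz using hz
  have hF0 : F ≠ 0 := by rintro rfl; simp at hF
  have ht := tendsto_abv_eval₂_atTop (algebraMap A K) abv F (natDegree_pos_iff_degree_pos.mp hF)
    (by simpa using hF0) (l := Filter.atTop) (z := fun n => algebraMap A K (z n))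
    (Filter.tendsto_atTop_mono (fun n => (hz n).le) tendsto_natCast_atTop_atTop)
  obtain ⟨n, hn⟩ := (ht.eventually_gt_atTop M).exists
  rw [eval₂_at_apply] at hn
  exact hn.not_ge (hM ⟨(h (z n)).unit, rfl⟩)

/-- The valuation of the values of a nonconstant polynomial exceeds every bound for arguments of
large valuation. -/
lemma exists_lt_val_eval {K Γ₀ : Type*} [Field K] [LinearOrderedCommGroupWithZero Γ₀]
    (val : Valuation K Γ₀) (n : ℕ) (F : K[X]) (hF : F.natDegree = n + 1) (M : Γ₀) :
    ∃ N : Γ₀, ∀ b : K, N < val b → M < val (F.eval b) := by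
  induction n generalizing F M with
  | zero =>
    obtain ⟨a, ha, e, rfl⟩ := natDegree_eq_one.mp hF
    refine ⟨max M (val e) / val a, fun b hb => ?_⟩
    rw [div_lt_iff₀ (zero_lt_iff.mpr (val.ne_zero_iff.mpr ha)), ← map_mul, mul_comm b,
      max_lt_iff] at hb
    rw [eval_add, eval_mul, eval_C, eval_X, eval_C, val.map_add_eq_of_lt_left hb.2]
    exact hb.1
  | succ n ih =>
    obtain ⟨N, hN⟩ := ih F.divX (by rw [natDegree_divX_eq_natDegree_tsub_one, hF]; rfl)
      (max M (val (F.coeff 0)))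
    -- The bound 1 ensures that multiplying by `b` does not decrease the valuation of `F.divX.eval
    -- b`.
    refine ⟨max N 1, fun b hb => ?_⟩
    rw [max_lt_iff] at hb
    have h : max M (val (F.coeff 0)) < val (F.divX.eval b * b) := by
      refine (hN b hb.1).trans_le ?_
      rw [map_mul]
      exact le_mul_of_one_le_right' hb.2.le
    rw [max_lt_iff] at h
    rw [← F.divX_mul_X_add, eval_add, eval_mul, eval_X, eval_C, val.map_add_eq_of_lt_left
      (by simpa using h.2)]
    simpa using h.1

/-- A domain with a valuation that is unbounded but bounded on units satisfies (P2). -/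
lemma SatisfiesP2.of_valuation {A : Type*} [CommRing A] [IsDomain A] {K : Type*} [Field K]
    [Algebra A K] [IsFractionRing A K] {Γ₀ : Type*} [LinearOrderedCommGroupWithZero Γ₀]
    (val : Valuation K Γ₀)
    (hA : ¬ BddAbove (Set.range fun a : A => val (algebraMap A K a)))
    (hu : BddAbove (Set.range fun a : Aˣ => val (algebraMap A K (a : A)))) :
    SatisfiesP2 A := by
  intro F hF
  by_contra! h
  obtain ⟨M, hM⟩ := hu
  obtain ⟨N, hN⟩ := exists_lt_val_eval val (F.natDegree - 1) (F.map (algebraMap A K))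
    (by rw [natDegree_map_eq_of_injective (IsFractionRing.injective A K)]; lia) M
  obtain ⟨_, ⟨a, rfl⟩, ha⟩ := not_bddAbove_iff.mp hA N
  have := hN _ ha
  rw [Polynomial.eval_map, eval₂_at_apply] at this
  exact this.not_ge (hM ⟨(h a).unit, rfl⟩)

lemma satisfiesP2_int : SatisfiesP2 ℤ := by
  refine SatisfiesP2.of_abv (K := ℚ) (Rat.AbsoluteValue.real) ?_ ⟨1, ?_⟩
  · rw [not_bddAbove_iff]
    intro x
    obtain ⟨n, hn⟩ := exists_nat_gt x
    exact ⟨_, ⟨n, rfl⟩, by simpa using hn⟩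
  · rintro _ ⟨a, rfl⟩
    rcases Int.units_eq_one_or a with rfl | rfl <;> simp

lemma satisfiesP2_polynomial (k : Type*) [Field k] : SatisfiesP2 k[X] := by
  classical
  refine SatisfiesP2.of_valuation (K := RatFunc k) (RatFunc.inftyValuation k) ?_ ⟨1, ?_⟩
  · rw [not_bddAbove_iff]
    intro x
    obtain ⟨n, hn⟩ : ∃ n : ℕ, x < WithZero.exp (n : ℤ) := by
      induction x using WithZero.expRecOn with
      | zero => exact ⟨0, by simp⟩
      | exp m => exact ⟨m.toNat + 1, by rw [WithZero.exp_lt_exp]; omega⟩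
    refine ⟨_, ⟨X ^ n, rfl⟩, ?_⟩
    change x < RatFunc.inftyValuationDef k _
    rw [RatFunc.inftyValuation.polynomial k (pow_ne_zero _ X_ne_zero)]
    simpa using hn
  · rintro _ ⟨a, rfl⟩
    simp [RatFunc.inftyValuation_apply]

/-! ### Specializing a finite extension of the fraction field -/

/-- Under (P2), the non-unit value can be taken in a maximal ideal avoiding a given nonzero
element. -/
lemma SatisfiesP2.exists_isMaximal {A : Type*} [CommRing A] [IsDomain A] (hA : SatisfiesP2 A)
    (F : A[X]) (hF : 0 < F.natDegree) {c : A} (hc : c ≠ 0) :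
    ∃ (b : A) (p : Ideal A), p.IsMaximal ∧ F.eval b ∈ p ∧ c ∉ p := by
  -- An ideal containing both `c` and `1 + c * G(b)` contains 1.
  have key : ∀ G : A[X], 0 < (1 + C c * G).natDegree →
      ∃ (b : A) (p : Ideal A), p.IsMaximal ∧ 1 + c * G.eval b ∈ p ∧ c ∉ p := by
    intro G hG
    obtain ⟨b, hb⟩ := hA _ hG
    obtain ⟨p, hp, hbp⟩ := exists_max_ideal_of_mem_nonunits hb
    have hbp : 1 + c * G.eval b ∈ p := by simpa using hbp
    refine ⟨b, p, hp, hbp, fun hcp => hp.ne_top ?_⟩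
    rw [Ideal.eq_top_iff_one]
    exact (Ideal.add_mem_iff_left _ (p.mul_mem_right _ hcp)).mp hbp
  by_cases he : F.coeff 0 = 0
  -- Here 0 is a root of `F`, so any maximal ideal avoiding `c` will do.
  · obtain ⟨-, p, hp, -, hcp⟩ := key X (by
      rw [add_comm, ← C_1, natDegree_linear hc]; exact one_pos)
    exact ⟨0, p, hp, by simp [← coeff_zero_eq_eval_zero, he], hcp⟩
  · set e := F.coeff 0
    -- Substituting `e * c * X` makes every nonconstant term divisible by `e * c`, so the constant
    -- term `e` factors out.
    have hFe : F.comp (C (e * c) * X) = C e * (1 + C c * (X * F.divX.comp (C (e * c) * X))) := by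
      conv_lhs => rw [← F.divX_mul_X_add]
      simp only [add_comp, mul_comp, X_comp, C_comp, map_mul]
      ring
    obtain ⟨b, p, hp, hbp, hcp⟩ := key (X * F.divX.comp (C (e * c) * X)) (by
      rw [← natDegree_C_mul he, ← hFe, natDegree_comp, natDegree_C_mul_X _ (mul_ne_zero he hc)]
      simpa using hF)
    refine ⟨e * c * b, p, hp, ?_, hcp⟩
    have := congr(eval b $hFe)
    simp only [eval_comp, eval_mul, eval_C, eval_X, eval_add, eval_one] at this
    rw [this]
    exact p.mul_mem_left _ (by simpa using hbp)

/-- Let `α` be a root in `L` of a monic polynomial `F` over `O` that becomes the minimal polynomial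
of `α` over `K`. A root `b` of `F` modulo a prime `m` extends, as a specialization of `α`, to a
prime of a ring of elements of `L` integral over `O[α]`. -/
lemma exists_prime_integral_over_adjoin {O K L : Type*} [CommRing O] [Field K] [Field L]
    [Algebra O K] [Algebra K L] [Algebra O L] [IsScalarTower O K L]
    (hinj : Function.Injective (algebraMap O K)) (α : L) (F : O[X])
    (hF : F.map (algebraMap O K) = minpoly K α) (hα : IsIntegral K α) (m : Ideal O) [m.IsPrime]
    (b : O) (hb : F.eval b ∈ m) :
    ∃ (C : Subring L) (Q : Ideal C), Q.IsPrime ∧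
      (∀ (x : L) (n : ℕ) (g : O[X]), 0 < n → x ^ n = aeval α g → x ∈ C) ∧
      ∀ g : O[X], ∃ h : aeval α g ∈ C, (⟨_, h⟩ : C) ∈ Q ↔ g.eval b ∈ m := by
  have hmonic : F.Monic := monic_of_injective hinj (hF ▸ minpoly.monic hα)
  let : Algebra O[X] L := (aeval α : O[X] →ₐ[O] L).toRingHom.toAlgebra
  have halg : ∀ g : O[X], algebraMap O[X] L g = aeval α g := fun _ => rfl
  let P : Ideal O[X] := m.comap (evalRingHom b)
  -- Relations satisfied by `α` over `O` are multiples of the monic `F`, hence vanish at `b` modulo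
  -- `m`.
  have hker : (⊥ : Ideal (integralClosure O[X] L)).comap (algebraMap O[X] _) ≤ P := by
    intro g hg
    have hg : aeval α g = 0 := congr(((↑) : integralClosure O[X] L → L) $hg)
    have hdvd : F ∣ g := by
      rw [← map_dvd_map _ hinj hmonic, hF]
      exact minpoly.dvd K α (by rw [aeval_map_algebraMap, hg])
    obtain ⟨h, rfl⟩ := hdvd
    change eval b _ ∈ m
    rw [eval_mul]
    exact m.mul_mem_right _ hb
  obtain ⟨Q, -, hQ, hQP⟩ := Ideal.exists_ideal_over_prime_of_isIntegral P ⊥ hker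
  refine ⟨(integralClosure O[X] L).toSubring, Q, hQ, fun x n g hn hx => ?_, fun g => ?_⟩
  · change IsIntegral O[X] x
    refine IsIntegral.of_pow hn ?_
    rw [hx]
    exact isIntegral_algebraMap (x := g)
  · refine ⟨isIntegral_algebraMap (R := O[X]) (x := g), ?_⟩
    change algebraMap O[X] (integralClosure O[X] L) g ∈ Q ↔ g ∈ P
    rw [← hQP]; rfl

/-- Clearing denominators in finitely many polynomials. -/
lemma exists_common_denominator {A K : Type*} [CommRing A] [IsDomain A] [Field K] [Algebra A K]
    [IsFractionRing A K] (s : Finset K[X]) :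
    ∃ c : A, c ≠ 0 ∧ ∀ g ∈ s, ∃ G : A[X], G.map (algebraMap A K) = C (algebraMap A K c) * g := by
  classical
  obtain ⟨c, hc⟩ := IsLocalization.exist_integer_multiples_of_finset (nonZeroDivisors A)
    (s.biUnion fun g => g.support.image g.coeff)
  refine ⟨c, nonZeroDivisors.coe_ne_zero c, fun g hg => ?_⟩
  rw [← mem_lifts, lifts_iff_coeff_lifts]
  intro n
  rw [coeff_C_mul]
  by_cases hn : g.coeff n = 0
  · exact ⟨0, by simp [hn]⟩
  · obtain ⟨a, ha⟩ := hc (g.coeff n) (Finset.mem_biUnion.mpr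
      ⟨g, hg, Finset.mem_image_of_mem _ (by simpa using hn)⟩)
    exact ⟨a, by rw [ha, Algebra.smul_def]⟩

/-- Let `L` be a finite extension of the fraction field of a domain `A` satisfying (P2). Finitely many
elements of `L` lie in a subalgebra `C` with a prime `Q` such that modulo `Q` each of them has a
power, of exponent a power of the characteristic exponent, that is a fraction over `A`. -/
lemma SatisfiesP2.exists_prime_of_finite {A K L : Type*} [CommRing A] [IsDomain A]
    (hA : SatisfiesP2 A) [Field K] [Algebra A K] [IsFractionRing A K] [Field L] [Algebra K L]
    [Algebra A L] [IsScalarTower A K L] [FiniteDimensional K L] (e : ℕ) [ExpChar K e]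
    (s : Finset L) :
    ∃ (C : Subalgebra A L) (Q : Ideal C), Q.IsPrime ∧ ∀ x ∈ s, ∃ h : x ∈ C,
      ∃ (n : ℕ) (a t : A), algebraMap A C t ∉ Q ∧
        (⟨x, h⟩ : C) ^ e ^ n * algebraMap A C t - algebraMap A C a ∈ Q := by
  classical
  obtain ⟨α, hα⟩ := Field.exists_primitive_element K (separableClosure K L)
  have hpow : ∀ x : L, ∃ (n : ℕ) (g : K[X]), x ^ e ^ n = aeval (α : L) g := by
    intro x
    have : ExpChar (separableClosure K L) e := expChar_of_injective_algebraMap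
      (algebraMap K (separableClosure K L)).injective e
    obtain ⟨n, y, hy⟩ := IsPurelyInseparable.pow_mem (separableClosure K L) e x
    have hyα : y ∈ IntermediateField.adjoin K {α} := hα ▸ IntermediateField.mem_top
    rw [← IntermediateField.mem_toSubalgebra, IntermediateField.adjoin_simple_toSubalgebra_of_isAlgebraic
      (Algebra.IsAlgebraic.isAlgebraic α), Algebra.adjoin_singleton_eq_range_aeval] at hyα
    obtain ⟨g, rfl⟩ := hyα
    refine ⟨n, g, ?_⟩
    rw [← hy]
    exact (aeval_algebraMap_apply L α g).symm
  choose n g hng using hpow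
  have hint : IsIntegral K (α : L) := Algebra.IsIntegral.isIntegral _
  obtain ⟨c, hc, hcs⟩ := exists_common_denominator (A := A)
    (insert (minpoly K (α : L)) (s.image g))
  obtain ⟨F, hF⟩ := hcs _ (Finset.mem_insert_self _ _)
  have hcK : algebraMap A K c ≠ 0 := by simpa using hc
  have hdeg : 0 < F.natDegree := by
    rw [← natDegree_map_eq_of_injective (IsFractionRing.injective A K), hF, natDegree_C_mul hcK]
    exact minpoly.natDegree_pos hint
  obtain ⟨b, p, hp, hbp, hcp⟩ := hA.exists_isMaximal F hdeg hc
  -- Since `c ∉ p`, the denominator `c` is invertible in the localization at `p`.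
  let O : Subalgebra A K := Localization.subalgebra.ofField K p.primeCompl p.primeCompl_le_nonZeroDivisors
  have : IsLocalization.AtPrime O p :=
    Localization.subalgebra.isLocalization_ofField K p.primeCompl p.primeCompl_le_nonZeroDivisors
  have : IsLocalRing O := IsLocalization.AtPrime.isLocalRing O p
  have hmem : ∀ a : A, algebraMap A O a ∈ IsLocalRing.maximalIdeal O ↔ a ∈ p := fun a =>
    IsLocalization.AtPrime.to_map_mem_maximal_iff O p a
  obtain ⟨u, hu⟩ : IsUnit (algebraMap A O c) := by
    by_contra h; exact hcp ((hmem c).mp h)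
  have huK : algebraMap O K ↑u⁻¹ * algebraMap A K c = 1 := by
    rw [IsScalarTower.algebraMap_apply A O K, ← hu, ← map_mul, Units.inv_mul, map_one]
  have hlift : ∀ (G : A[X]) (g : K[X]), G.map (algebraMap A K) = C (algebraMap A K c) * g →
      (C (↑u⁻¹ : O) * G.map (algebraMap A O)).map (algebraMap O K) = g := by
    intro G g h
    rw [Polynomial.map_mul, map_C, map_map, ← IsScalarTower.algebraMap_eq, h, ← mul_assoc, ← C_mul, huK, C_1,
      one_mul]
  obtain ⟨C₀, Q, hQ, hC, hCQ⟩ := exists_prime_integral_over_adjoin (K := K) (L := L)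
    (FaithfulSMul.algebraMap_injective O K) (α : L) _ (hlift F _ hF) hint
    (IsLocalRing.maximalIdeal O) (algebraMap A O b) (by
      rw [eval_mul, eval_map_algebraMap, aeval_algebraMap_apply]
      refine Ideal.mul_mem_left _ _ ((hmem _).mpr ?_)
      simpa using hbp)
  have hAC : ∀ a : A, aeval (α : L) (C (algebraMap A O a)) = algebraMap A L a := fun a => by
    rw [aeval_C, ← IsScalarTower.algebraMap_apply]
  let C' : Subalgebra A L :=
    { C₀ with algebraMap_mem' := fun a => by obtain ⟨h, -⟩ := hCQ (C (algebraMap A O a)); rwa [hAC] at h }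
  refine ⟨C', Q, hQ, fun x hx => ?_⟩
  obtain ⟨G, hG⟩ := hcs _ (Finset.mem_insert_of_mem (Finset.mem_image_of_mem g hx))
  have hxG := hng x
  rw [← hlift G _ hG, aeval_map_algebraMap] at hxG
  set g' : O[X] := C (↑u⁻¹ : O) * G.map (algebraMap A O)
  have hxC : x ∈ C' := hC x _ _ (pow_pos (expChar_pos K e) _) hxG
  obtain ⟨⟨a, t⟩, hat⟩ := IsLocalization.surj p.primeCompl (g'.eval (algebraMap A O b))
  refine ⟨hxC, n x, a, t, ?_, ?_⟩
  · obtain ⟨h, hiff⟩ := hCQ (C (algebraMap A O t))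
    rw [eval_C, hmem] at hiff
    intro ht
    refine t.2 (hiff.mp ?_)
    have heq : (⟨_, h⟩ : C') = algebraMap A C' t := Subtype.ext (hAC t)
    change (⟨_, h⟩ : C') ∈ Q
    rwa [heq]
  · obtain ⟨h, hiff⟩ := hCQ (g' * C (algebraMap A O t) - C (algebraMap A O a))
    have : eval (algebraMap A O b) (g' * C (algebraMap A O t) - C (algebraMap A O a)) = 0 := by
      simp only [eval_sub, eval_mul, eval_C]
      rw [sub_eq_zero]; exact hat
    rw [this] at hiff
    have heq : (⟨x, hxC⟩ : C') ^ e ^ n x * algebraMap A C' t - algebraMap A C' a = ⟨_, h⟩ := by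
      refine Subtype.ext ?_
      change x ^ e ^ n x * algebraMap A L t - algebraMap A L a = aeval (α : L) _
      rw [map_sub, map_mul, hAC, hAC, hxG]
    rw [heq]
    exact hiff.mpr (zero_mem _)

/-! ### Purely inseparable points of finite type algebras -/

/-- A criterion for pure inseparability of a residue field extension in terms of generators. -/
lemma isPurelyInseparable_of_adjoin_eq_top {A R F E : Type*} [CommRing A] [CommRing R]
    [Algebra A R] [Field F] [Field E] (i : A →+* F) (j : R →+* E) (k : F →+* E)
    (hk : ∀ a, k (i a) = j (algebraMap A R a)) (hj : ∀ y, ∃ r r', y = j r / j r')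
    (s : Finset R) (hs : Algebra.adjoin A (s : Set R) = ⊤) (e : ℕ)
    (he : e = 1 ∨ e.Prime ∧ (e : A) = 0)
    (H : ∀ x ∈ s, ∃ (n : ℕ) (a t : A), algebraMap A R t ∉ RingHom.ker j ∧
        x ^ e ^ n * algebraMap A R t - algebraMap A R a ∈ RingHom.ker j) :
    k.IsPurelyInseparable := by
  algebraize [k]
  have hk : ∀ a, algebraMap F E (i a) = j (algebraMap A R a) := hk
  change IsPurelyInseparable F E
  obtain ⟨f, hf⟩ := ExpChar.exists F
  -- The exponent `e` comes from `A`, and `f` from the residue field `F`: they agree if `e` is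
  -- prime, while `e = 1` only gives the exponent `f ^ 0`, whatever `f` is.
  have hexp : ∀ n : ℕ, ∃ m : ℕ, e ^ n = f ^ m := by
    intro n
    rcases he with rfl | ⟨he, he0⟩
    · exact ⟨0, by simp⟩
    · have h0 : (e : F) = 0 := by
        rw [← map_natCast i, he0, map_zero]
      have := Fact.mk he
      have : CharP F e := (CharP.charP_iff_prime_eq_zero he).mpr h0
      have : ExpChar F e := expChar_prime _ e
      exact ⟨n, by rw [ExpChar.eq hf ‹ExpChar F e›]⟩
  have hR : ∀ r : R, j r ∈ perfectClosure F E := by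
    intro r
    have hr : r ∈ Algebra.adjoin A (s : Set R) := hs ▸ Algebra.mem_top
    induction hr using Algebra.adjoin_induction with
    | mem x hx =>
      obtain ⟨n, a, t, ht, hxat⟩ := H x hx
      obtain ⟨m, hm⟩ := hexp n
      rw [mem_perfectClosure_iff_pow_mem f]
      refine ⟨m, i a / i t, ?_⟩
      rw [← hm, map_div₀, hk, hk, ← map_pow, eq_comm, eq_div_iff ht, ← map_mul, ← sub_eq_zero,
        ← map_sub]
      exact hxat
    | algebraMap a => rw [← hk]; exact IntermediateField.algebraMap_mem _ _
    | add x y _ _ hx hy => rw [map_add]; exact add_mem hx hy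
    | mul x y _ _ hx hy => rw [map_mul]; exact mul_mem hx hy
  rw [isPurelyInseparable_iff_perfectClosure_eq_top, eq_top_iff]
  rintro y -
  obtain ⟨r, r', rfl⟩ := hj y
  exact div_mem (hR r) (hR r')

/-- An algebra of finite type over a domain satisfying (P2) that contains the domain has a prime
whose residue field is purely inseparable over that of its contraction. The residue fields are
characterized here by their universal maps `i` and `j`. -/
theorem SatisfiesP2.exists_isPurelyInseparable {A R : Type*} [CommRing A] [IsDomain A]
    (hA : SatisfiesP2 A) [CommRing R] [Algebra A R] [Algebra.FiniteType A R]
    (hinj : Function.Injective (algebraMap A R)) :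
    ∃ q : PrimeSpectrum R, ∀ (F E : Type w) [Field F] [Field E] (i : A →+* F) (j : R →+* E)
      (k : F →+* E), (∀ a, k (i a) = j (algebraMap A R a)) → RingHom.ker j = q.asIdeal →
      (∀ y, ∃ r r', y = j r / j r') → k.IsPurelyInseparable := by
  classical
  let K := FractionRing A
  have : Nontrivial (TensorProduct A K R) :=
    Algebra.TensorProduct.nontrivial_of_algebraMap_injective_of_flat_left A K R hinj
  obtain ⟨m, hm⟩ := Ideal.exists_maximal (TensorProduct A K R)
  let L := TensorProduct A K R ⧸ m
  let : Field L := Ideal.Quotient.field m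
  have : Algebra.FiniteType K L := inferInstance
  -- Zariski's lemma.
  have : Module.Finite K L := finite_of_finite_type_of_isJacobsonRing K L
  let φ : R →ₐ[A] L := ((Ideal.Quotient.mkₐ K m).restrictScalars A).comp
    Algebra.TensorProduct.includeRight
  obtain ⟨s, hs⟩ := (Algebra.FiniteType.out : (⊤ : Subalgebra A R).FG)
  obtain ⟨e, he⟩ := ExpChar.exists K
  obtain ⟨C, Q, hQ, hCQ⟩ := hA.exists_prime_of_finite (K := K) e (s.image φ)
  have hφ : ∀ r, φ r ∈ C := by
    have : (Algebra.adjoin A (s : Set R)) ≤ C.comap φ := Algebra.adjoin_le fun x hx =>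
      (hCQ (φ x) (Finset.mem_image_of_mem _ hx)).1
    rw [hs] at this
    exact fun r => this Algebra.mem_top
  let ψ : R →ₐ[A] C := φ.codRestrict C hφ
  refine ⟨⟨Q.comap ψ, inferInstance⟩, fun F E _ _ i j k hk hker hj =>
    isPurelyInseparable_of_adjoin_eq_top i j k hk hj s hs e ?_ fun x hx => ?_⟩
  · rcases he with _ | ⟨he⟩
    · exact .inl rfl
    · exact .inr ⟨he, IsFractionRing.injective A K (by simp)⟩
  · obtain ⟨h, n, a, t, ht, hat⟩ := hCQ (φ x) (Finset.mem_image_of_mem _ hx)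
    rw [hker]
    refine ⟨n, a, t, by simpa [Ideal.mem_comap] using ht, ?_⟩
    rw [Ideal.mem_comap, map_sub, map_mul, map_pow, AlgHom.commutes, AlgHom.commutes]
    exact hat

/-! ### Passage to schemes -/

/-- On an affine open, evaluation at the point of a prime has the prime as its kernel, and its values
generate the residue field. -/
lemma evaluation_fromSpec {X : Scheme.{u}} {V : X.Opens} (hV : IsAffineOpen V)
    (q : PrimeSpectrum Γ(X, V)) (hq : hV.fromSpec q ∈ V) :
    RingHom.ker (X.evaluation V (hV.fromSpec q) hq).hom = q.asIdeal ∧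
      ∀ y, ∃ r r', y = X.evaluation V (hV.fromSpec q) hq r / X.evaluation V (hV.fromSpec q) hq r' := by
  let := TopCat.Presheaf.algebra_section_stalk X.presheaf ⟨hV.fromSpec q, hq⟩
  have hloc : IsLocalization.AtPrime (X.presheaf.stalk (hV.fromSpec q)) q.asIdeal :=
    hV.isLocalization_stalk' q hq
  have hmem : ∀ r, X.evaluation V (hV.fromSpec q) hq r = 0 ↔ r ∈ q.asIdeal := fun r => by
    rw [← IsLocalization.AtPrime.to_map_mem_maximal_iff (X.presheaf.stalk (hV.fromSpec q)) q.asIdeal]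
    exact IsLocalRing.residue_eq_zero_iff _
  refine ⟨Ideal.ext hmem, fun y => ?_⟩
  obtain ⟨z, rfl⟩ := X.residue_surjective _ y
  obtain ⟨⟨r, t⟩, hrt⟩ := IsLocalization.surj q.asIdeal.primeCompl z
  refine ⟨r, t, ?_⟩
  rw [eq_div_iff (fun h => t.2 ((hmem _).mp h))]
  have := congr(X.residue (hV.fromSpec q) $hrt)
  rw [map_mul] at this
  exact this

/-- A dominant quasi-compact morphism to an open subscheme of the spectrum of a domain restricts to
a morphism from some affine open that is dominant to the spectrum. -/
lemma exists_isAffineOpen_denseRange {A : CommRingCat.{u}} [IsDomain A] (U : (Spec A).Opens)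
    (hU : (U : Set (Spec A)).Nonempty) {X : Scheme.{u}} (f : X ⟶ U.toScheme) [QuasiCompact f]
    [IsDominant f] :
    ∃ (V : X.Opens) (hV : IsAffineOpen V), DenseRange (hV.fromSpec ≫ f ≫ U.ι) := by
  let η : PrimeSpectrum A := ⟨⊥, Ideal.isPrime_bot⟩
  have hspec : ∀ x : PrimeSpectrum A, η ⤳ x := fun x =>
    (PrimeSpectrum.le_iff_specializes η x).mp (bot_le (a := x.asIdeal))
  have hηU : η ∈ U := by
    obtain ⟨x, hx⟩ := hU
    exact (hspec x).mem_open U.isOpen hx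
  let ξ : U.toScheme := ⟨η, hηU⟩
  obtain ⟨_, ⟨W, hW, rfl⟩, hξW, -⟩ :=
    U.toScheme.isBasis_affineOpens.exists_subset_of_mem_open (Set.mem_univ ξ) isOpen_univ
  have hWc : IsCompact (f ⁻¹ᵁ W : Set X) := f.isCompact_preimage hW.isCompact
  obtain ⟨S, hS, hSW⟩ := isCompact_and_isOpen_iff_finite_and_eq_biUnion_affineOpens.mp
    ⟨hWc, (f ⁻¹ᵁ W).isOpen⟩
  have hξ : ξ ∈ closure (f '' (f ⁻¹ᵁ W : Set X)) := by
    rw [mem_closure_iff]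
    intro N hN hξN
    obtain ⟨x, hx⟩ := f.denseRange.exists_mem_open (hN.inter W.isOpen) ⟨_, hξN, hξW⟩
    exact ⟨f x, hx.1, x, hx.2, rfl⟩
  -- Closure commutes with finite unions, so one affine piece already has the generic point in the
  -- closure of its image.
  obtain ⟨V, hV, hξV⟩ : ∃ V ∈ S, ξ ∈ closure (f '' (V : Set X)) := by
    rw [hSW, Set.image_iUnion₂, hS.closure_biUnion] at hξ
    simpa using hξ
  refine ⟨V, V.2, fun y => ?_⟩
  have hrange : Set.range (V.2.fromSpec ≫ f ≫ U.ι) = U.ι '' (f '' (V : Set X)) := by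
    rw [← V.2.range_fromSpec, ← Set.range_comp, ← Set.range_comp]
    ext; simp
  rw [hrange]
  exact (hspec y).mem_closed isClosed_closure
    (image_closure_subset_closure_image U.ι.continuous ⟨_, hξV, rfl⟩)

/-- A domain satisfying (P2) is a Poonen ring. -/
theorem SatisfiesP2.isPoonenRing {A : Type u} [CommRing A] [IsDomain A] (hA : SatisfiesP2 A) :
    IsPoonenRing A := by
  intro U hU X f _ _ _ _
  obtain ⟨V, hV, hdense⟩ := exists_isAffineOpen_denseRange (A := .of A) U hU f
  have hle : V ≤ (f ≫ U.ι) ⁻¹ᵁ ⊤ := le_top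
  let φ : CommRingCat.of A ⟶ Γ(X, V) :=
    (Scheme.ΓSpecIso (.of A)).inv ≫ (f ≫ U.ι).appLE ⊤ V hle
  have hφ : Spec.map φ = hV.fromSpec ≫ f ≫ U.ι := by
    rw [Spec.map_comp, ← Scheme.isoSpec_Spec_inv, ← IsAffineOpen.fromSpec_top,
      IsAffineOpen.SpecMap_appLE_fromSpec]
  algebraize [φ.hom]
  have : Algebra.FiniteType A Γ(X, V) := by
    have : LocallyOfFiniteType (Spec.map φ) := hφ ▸ inferInstance
    exact (HasRingHomProperty.Spec_iff (P := @LocallyOfFiniteType)).mp this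
  have hinj : Function.Injective φ.hom := by
    rw [← hφ] at hdense
    have := (PrimeSpectrum.denseRange_comap_iff_ker_le_nilRadical _).mp hdense
    rwa [nilradical_eq_zero, Ideal.zero_eq_bot, le_bot_iff, ← RingHom.injective_iff_ker_eq_bot]
      at this
  obtain ⟨q, hq⟩ := hA.exists_isPurelyInseparable hinj
  let x : X := hV.fromSpec q
  have hxV : x ∈ V := hV.range_fromSpec.le ⟨q, rfl⟩
  refine ⟨f x, x, hq _ _ ((Scheme.ΓSpecIso (.of A)).inv ≫ U.ι.appTop ≫
    U.toScheme.Γevaluation (f x)).hom (X.evaluation V x hxV).hom (f.residueFieldMap x).hom ?_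
    (evaluation_fromSpec hV q hxV).1 (evaluation_fromSpec hV q hxV).2, rfl⟩
  intro a
  have h := Scheme.Γevaluation_naturality_apply f x (U.ι.appTop ((Scheme.ΓSpecIso (.of A)).inv a))
  refine h.trans ?_
  change X.residue x (X.presheaf.germ ⊤ x trivial ((f ≫ U.ι).appTop _)) =
    X.residue x (X.presheaf.germ V x hxV (X.presheaf.map (homOfLE hle).op ((f ≫ U.ι).appTop _)))
  exact congrArg _ (X.presheaf.germ_res_apply (homOfLE hle) x hxV _).symm

end PoonenScheme

theorem mainTheorem9 :
    (∀ (A : Type u) [CommRing A] [IsDomain A] (K : Type v) [Field K] [Algebra A K]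
        [IsFractionRing A K] (abv : AbsoluteValue K ℝ),
      ¬ BddAbove (Set.range fun a : A => abv (algebraMap A K a)) →
      BddAbove (Set.range fun a : Aˣ => abv (algebraMap A K (a : A))) →
        PoonenScheme.SatisfiesP2 A ∧ PoonenScheme.IsPoonenRing A) ∧
    (∀ (A : Type u) [CommRing A] [IsDomain A] (K : Type v) [Field K] [Algebra A K]
        [IsFractionRing A K] (Γ₀ : Type w) [LinearOrderedCommGroupWithZero Γ₀]
        (val : Valuation K Γ₀),
      ¬ BddAbove (Set.range fun a : A => val (algebraMap A K a)) →
      BddAbove (Set.range fun a : Aˣ => val (algebraMap A K (a : A))) →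
        PoonenScheme.SatisfiesP2 A ∧ PoonenScheme.IsPoonenRing A) ∧
    (PoonenScheme.SatisfiesP2 ℤ ∧ PoonenScheme.IsPoonenRing ℤ) ∧
    (∀ (k : Type u) [Field k],
      PoonenScheme.SatisfiesP2 k[X] ∧ PoonenScheme.IsPoonenRing k[X]) := by
  refine ⟨fun A _ _ K _ _ _ abv hA hu => ?_, fun A _ _ K _ _ _ Γ₀ _ val hA hu => ?_, ?_,
    fun k _ => ?_⟩
  · have h := PoonenScheme.SatisfiesP2.of_abv abv hA hu
    exact ⟨h, h.isPoonenRing⟩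
  · have h := PoonenScheme.SatisfiesP2.of_valuation val hA hu
    exact ⟨h, h.isPoonenRing⟩
  · exact ⟨PoonenScheme.satisfiesP2_int, PoonenScheme.satisfiesP2_int.isPoonenRing⟩
  · have h := PoonenScheme.satisfiesP2_polynomial k
    exact ⟨h, h.isPoonenRing⟩
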